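/- For every integer $k \ge 2$ there exists a finite simple graph $G$ that is connected, $k$-regular, has girth at least $k+2$ (the girth being the length of a shortest cycle), and is not $k$-edge-colourable, i.e. its edges cannot be coloured with $k$ colours so that any two distinct edges sharing an endpoint receive different colours. Moreover, $G$ can be chosen to have an odd number of vertices if $k$ is even, and to have a cut vertex (a vertex whose deletion increases the number of connected components) if $k$ is odd. -/

import Mathlib

/-- A graph is `k`-edge-colourable if its edges can be coloured with (at most) `k` colours so that
any two distinct edges sharing an endpoint receive distinct colours. -/
def SimpleGraph.EdgeColourable {V : Type*} (G : SimpleGraph V) (k : ℕ) : Prop :=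
  ∃ c : G.EdgeLabeling (Fin k), ∀ e f : G.edgeSet, e ≠ f →
    (∃ v : V, v ∈ (e : Sym2 V) ∧ v ∈ (f : Sym2 V)) → c e ≠ c f

/-- A cut vertex of `G` is a vertex `v` whose deletion disconnects some component of `G`: there are
two other vertices that are joined by a walk in `G` but not in `G - v`. -/
def SimpleGraph.IsCutVertex {V : Type*} (G : SimpleGraph V) (v : V) : Prop :=
  ∃ x y : ({v}ᶜ : Set V), G.Reachable x y ∧ ¬ (G.induce ({v}ᶜ : Set V)).Reachable x y

/-! On an odd number n of vertices a colour class has at most (n-1)/2 edges, so a degree sum above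
k(n-1) rules out k colours. As k ≥ 2, it is enough to have a connected graph of odd order, with
girth at least k+2 and degrees at most k, that misses at most one unit of degree. Among the graphs
on a large odd vertex set that obey the girth and degree bounds, take one of maximum degree sum: if
two units were missing, exchanging edges far away would increase it
(`NoShortCycle.exists_sum_ndeg_lt`). A component of odd order inherits all the bounds. The degree
sum is even. Hence for k even nothing is missing, and for k odd a single vertex x misses one unit;
`joinCopies` supplies it by a bridge between two copies of x, whose ends are cut vertices. -/

namespace SimpleGraph

variable {V W : Type*}

/-! ### Walks of bounded length -/

/-- The vertices `a` and `b` are joined by a walk of length at most `m`. -/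
def WithinDist (G : SimpleGraph V) (m : ℕ) (a b : V) : Prop :=
  ∃ p : G.Walk a b, p.length ≤ m

/-- The graph has no cycle of length at most `m + 1`: deleting an edge moves its endpoints to
distance greater than `m`. -/
def NoShortCycle (G : SimpleGraph V) (m : ℕ) : Prop :=
  ∀ a b, G.Adj a b → ¬ (G \ edge a b).WithinDist m a b

/-- The degree of a vertex, as a natural number that needs no decidability instances. -/
noncomputable def ndeg (G : SimpleGraph V) (v : V) : ℕ := (G.neighborSet v).ncard

namespace WithinDist

variable {G H K : SimpleGraph V} {m i j : ℕ} {a b c x u : V}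

theorem refl (G : SimpleGraph V) (m : ℕ) (a : V) : G.WithinDist m a a := ⟨.nil, by simp⟩

theorem symm (h : G.WithinDist m a b) : G.WithinDist m b a := by
  obtain ⟨p, hp⟩ := h
  exact ⟨p.reverse, by simpa using hp⟩

theorem mono_right (h : G.WithinDist i a b) (hij : i ≤ j) : G.WithinDist j a b := by
  obtain ⟨p, hp⟩ := h
  exact ⟨p, hp.trans hij⟩

theorem trans (h : G.WithinDist i a b) (h' : G.WithinDist j b c) :
    G.WithinDist (i + j) a c := by
  obtain ⟨p, hp⟩ := h
  obtain ⟨q, hq⟩ := h'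
  exact ⟨p.append q, by rw [Walk.length_append]; lia⟩

theorem cons (h : G.Adj a b) (h' : G.WithinDist m b c) : G.WithinDist (m + 1) a c := by
  obtain ⟨q, hq⟩ := h'
  exact ⟨.cons h q, by simpa using hq⟩

theorem succ_iff :
    G.WithinDist (m + 1) a b ↔ G.WithinDist m a b ∨ ∃ c, G.Adj a c ∧ G.WithinDist m c b := by
  constructor
  · rintro ⟨p, hp⟩
    cases p with
    | nil => exact .inl (refl _ _ _)
    | cons h q => exact .inr ⟨_, h, q, by simpa using hp⟩
  · rintro (h | ⟨c, h, h'⟩)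
    · exact h.mono_right (by lia)
    · exact cons h h'

theorem zero_iff : G.WithinDist 0 a b ↔ a = b := by
  constructor
  · rintro ⟨p, hp⟩
    exact Walk.eq_of_length_eq_zero (p := p) (by lia)
  · rintro rfl
    exact refl _ _ _

/-- Maps that send each edge to an edge or to a single vertex do not increase distances. -/
theorem map {G : SimpleGraph V} {H : SimpleGraph W} (f : V → W)
    (hf : ∀ a b, G.Adj a b → f a = f b ∨ H.Adj (f a) (f b)) (h : G.WithinDist m a b) :
    H.WithinDist m (f a) (f b) := by
  induction m generalizing a with
  | zero => rw [zero_iff] at h; subst h; exact refl _ _ _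
  | succ m ih =>
    rcases succ_iff.1 h with h | ⟨c, hc, h⟩
    · exact (ih h).mono_right (by lia)
    · rcases hf _ _ hc with e | e
      · rw [e]; exact (ih h).mono_right (by lia)
      · exact cons e (ih h)

theorem mono (hGH : G ≤ H) (h : G.WithinDist m a b) : H.WithinDist m a b :=
  h.map id fun _ _ hab => .inr (hGH hab)

/-- A walk in a graph with an added edge either can be replaced by a walk that avoids it, or
splits at its only use. -/
theorem of_add_edge (hH : ∀ p q, H.Adj p q → K.Adj p q ∨ p = x ∧ q = u ∨ p = u ∧ q = x)
    (h : H.WithinDist m a b) :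
    K.WithinDist m a b ∨ (∃ i j, i + j + 1 ≤ m ∧ K.WithinDist i a x ∧ K.WithinDist j u b) ∨
      ∃ i j, i + j + 1 ≤ m ∧ K.WithinDist i a u ∧ K.WithinDist j x b := by
  induction m generalizing a with
  | zero => rw [zero_iff] at h; subst h; exact .inl (refl _ _ _)
  | succ m ih =>
    rcases succ_iff.1 h with h | ⟨c, hc, h⟩
    · rcases ih h with h | ⟨i, j, hij, h, h'⟩ | ⟨i, j, hij, h, h'⟩
      · exact .inl (h.mono_right (by lia))
      · exact .inr (.inl ⟨i, j, by lia, h, h'⟩)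
      · exact .inr (.inr ⟨i, j, by lia, h, h'⟩)
    · rcases hH _ _ hc with hac | ⟨rfl, rfl⟩ | ⟨rfl, rfl⟩
      · rcases ih h with h | ⟨i, j, hij, h, h'⟩ | ⟨i, j, hij, h, h'⟩
        · exact .inl (cons hac h)
        · exact .inr (.inl ⟨i + 1, j, by lia, cons hac h, h'⟩)
        · exact .inr (.inr ⟨i + 1, j, by lia, cons hac h, h'⟩)
      -- A further crossing makes what precedes it redundant: in the same direction only the later
      -- one is kept, in the opposite direction the walk is back at `a` and needs none.
      · rcases ih h with h | ⟨i, j, hij, h, h'⟩ | ⟨i, j, hij, h, h'⟩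
        · exact .inr (.inl ⟨0, m, by lia, refl _ _ _, h⟩)
        · exact .inr (.inl ⟨0, j, by lia, refl _ _ _, h'⟩)
        · exact .inl (h'.mono_right (by lia))
      · rcases ih h with h | ⟨i, j, hij, h, h'⟩ | ⟨i, j, hij, h, h'⟩
        · exact .inr (.inr ⟨0, m, by lia, refl _ _ _, h⟩)
        · exact .inl (h'.mono_right (by lia))
        · exact .inr (.inr ⟨0, j, by lia, refl _ _ _, h'⟩)

end WithinDist

/-! ### Short cycles and degrees when edges are added -/

variable {G H K : SimpleGraph V} {m : ℕ} {a b x u : V}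

theorem NoShortCycle.mono (hGH : G ≤ H) (h : H.NoShortCycle m) : G.NoShortCycle m :=
  fun a b hab hw => h a b (hGH hab) (hw.mono (sdiff_le_sdiff_right hGH))

theorem NoShortCycle.comap {G : SimpleGraph V} {H : SimpleGraph W} (f : G ↪g H)
    (h : H.NoShortCycle m) : G.NoShortCycle m := by
  intro a b hab hw
  refine h (f a) (f b) (f.map_adj_iff.2 hab) (hw.map f fun c d hcd => .inr ?_)
  rw [sdiff_adj, edge_adj] at hcd ⊢
  simpa [f.map_adj_iff, f.injective.eq_iff] using hcd

/-- An edge may be added between vertices that are far apart. -/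
theorem NoShortCycle.sup_edge (h : G.NoShortCycle m) (hxu : ¬ G.WithinDist m x u) :
    (G ⊔ edge x u).NoShortCycle m := by
  intro a b hab hw
  -- A short cycle through the old edge `ab` and the new edge `xu` would, without `xu`, be a walk in
  -- `G` from `x` to `u` of length at most `m`.
  have key : ∀ i j p q p' q', i + j + 1 ≤ m → s(p, q) = s(a, b) → s(p', q') = s(x, u) →
      G.Adj a b → (G \ edge a b).WithinDist i p p' → (G \ edge a b).WithinDist j q' q → False := by
    intro i j p q p' q' hij hpq hpq' hadj h1 h2
    have hqp : G.Adj p q := by rw [← mem_edgeSet, hpq]; exact hadj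
    have h3 : G.WithinDist m p' q' :=
      (((h1.mono sdiff_le).symm.trans
        (WithinDist.cons hqp (h2.mono sdiff_le).symm)).mono_right (by lia))
    rcases Sym2.eq_iff.1 hpq' with ⟨rfl, rfl⟩ | ⟨rfl, rfl⟩
    · exact hxu h3
    · exact hxu h3.symm
  by_cases hadj : G.Adj a b
  · have hK : ∀ p q, ((G ⊔ edge x u) \ edge a b).Adj p q →
        (G \ edge a b).Adj p q ∨ p = x ∧ q = u ∨ p = u ∧ q = x := by
      intro p q hpq
      simp only [sdiff_adj, sup_adj, edge_adj] at hpq ⊢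
      tauto
    rcases hw.of_add_edge hK with hw | ⟨i, j, hij, h1, h2⟩ | ⟨i, j, hij, h1, h2⟩
    · exact h a b hadj hw
    · exact key i j a b x u hij rfl rfl hadj h1 h2
    · exact key i j a b u x hij rfl Sym2.eq_swap hadj h1 h2
  -- Here `ab` is the new edge itself, so deleting it leaves only edges of `G`.
  · have hle : (G ⊔ edge x u) \ edge a b ≤ G := by
      intro p q hpq
      simp only [sdiff_adj, sup_adj, edge_adj] at hpq hab
      grind
    have := hw.mono hle
    simp only [sup_adj, edge_adj] at hab
    rcases hab with hab | ⟨⟨rfl, rfl⟩ | ⟨rfl, rfl⟩, -⟩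
    · exact hadj hab
    · exact hxu this
    · exact hxu this.symm

/-- A cycle minus its first edge is a walk between the ends of that edge, one step shorter than the
cycle. -/
theorem NoShortCycle.le_egirth (h : G.NoShortCycle m) : ((m + 2 : ℕ) : ℕ∞) ≤ G.egirth := by
  rw [SimpleGraph.le_egirth]
  intro a w hw
  cases w with
  | nil => simp at hw
  | @cons _ b _ hab p =>
    rw [Walk.cons_isCycle_iff] at hw
    by_contra hlt
    rw [Walk.length_cons, Nat.cast_le] at hlt
    have hp : ∀ e ∈ p.edges, e ∈ (G \ edge b a).edgeSet := by
      intro e he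
      rw [edgeSet_sdiff, edgeSet_edge_of_ne hab.ne']
      refine ⟨p.edges_subset_edgeSet he, ?_⟩
      rintro rfl
      exact hw.2 (Sym2.eq_swap ▸ he)
    exact h b a hab.symm ⟨p.transfer _ hp, by rw [Walk.length_transfer]; lia⟩

theorem ndeg_eq_degree [Fintype V] [DecidableRel G.Adj] (v : V) : G.ndeg v = G.degree v := by
  rw [ndeg, Set.ncard_eq_toFinset_card', ← card_neighborFinset_eq_degree, neighborFinset]

theorem ndeg_sup_edge [Finite V] [DecidableEq V] (hne : x ≠ u) (hn : ¬ G.Adj x u) (v : V) :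
    (G ⊔ edge x u).ndeg v = G.ndeg v + (if v = x then 1 else 0) + (if v = u then 1 else 0) := by
  unfold ndeg
  by_cases hx : v = x
  · subst hx
    have : (G ⊔ edge v u).neighborSet v = insert u (G.neighborSet v) := by
      ext w; simp [edge_adj]; grind
    rw [this, Set.ncard_insert_of_notMem (by simpa using hn)]
    simp [hne]
  by_cases hu : v = u
  · subst hu
    have : (G ⊔ edge x v).neighborSet v = insert x (G.neighborSet v) := by
      ext w; simp [edge_adj]; grind
    rw [this, Set.ncard_insert_of_notMem (by simpa [adj_comm] using hn)]
    simp [hne.symm]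
  · have : (G ⊔ edge x u).neighborSet v = G.neighborSet v := by
      ext w; simp [edge_adj]; grind
    simp [this, hx, hu]

theorem ndeg_sdiff_edge [Finite V] [DecidableEq V] (h : G.Adj x u) (v : V) :
    G.ndeg v = (G \ edge x u).ndeg v + (if v = x then 1 else 0) + (if v = u then 1 else 0) := by
  rw [← ndeg_sup_edge h.ne (by simp [edge_adj, h.ne]), sdiff_sup_cancel]
  exact (edge_le_iff _).2 (.inr h)

theorem ncard_withinDist_le [Finite V] {k : ℕ} (hdeg : ∀ v, G.ndeg v ≤ k) (m : ℕ) (x : V) :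
    {w | G.WithinDist m w x}.ncard ≤ (k + 1) ^ m := by
  classical
  have := Fintype.ofFinite V
  induction m with
  | zero => simp [WithinDist.zero_iff]
  | succ m ih =>
    have hsub : {w | G.WithinDist (m + 1) w x} ⊆
        {w | G.WithinDist m w x} ∪ ⋃ c ∈ {w | G.WithinDist m w x}.toFinset, G.neighborSet c := by
      intro w hw
      rcases WithinDist.succ_iff.1 hw with h | ⟨c, hc, h⟩
      · exact .inl h
      · exact .inr (Set.mem_biUnion (by simpa using h) hc.symm)
    have h2 : (⋃ c ∈ {w | G.WithinDist m w x}.toFinset, G.neighborSet c).ncard ≤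
        {w | G.WithinDist m w x}.ncard * k := by
      refine (Finset.set_ncard_biUnion_le _ _).trans ?_
      rw [Set.ncard_eq_toFinset_card']
      exact Finset.sum_le_card_nsmul _ _ _ fun v _ => hdeg v
    calc _ ≤ _ := (Set.ncard_le_ncard hsub).trans (Set.ncard_union_le _ _)
      _ ≤ {w | G.WithinDist m w x}.ncard * (k + 1) := by lia
      _ ≤ _ := by rw [pow_succ]; gcongr

/-! ### Nearly regular graphs of large girth -/

variable {k : ℕ}

/-- In a graph with many vertices that has two units of missing degree, one at `x` and one at `y`,
there is room for one more edge. -/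
theorem NoShortCycle.exists_sum_ndeg_lt [Fintype V] [DecidableEq V]
    (hk : 1 ≤ k) (hm : 1 ≤ m) (hcard : 2 * (k + 1) ^ (m + 1) < Fintype.card V)
    (hG : G.NoShortCycle m) {x y : V}
    (hdeg : ∀ v, G.ndeg v + (if v = x then 1 else 0) + (if v = y then 1 else 0) ≤ k) :
    ∃ H : SimpleGraph V, H.NoShortCycle m ∧ (∀ v, H.ndeg v ≤ k) ∧
      ∑ v, G.ndeg v < ∑ v, H.ndeg v := by
  have hdeg' : ∀ v, G.ndeg v ≤ k := fun v => by have := hdeg v; lia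
  -- The two balls cannot cover `V`. Radius `m + 1` rather than `m` keeps every neighbour of `u`
  -- farther than `m` from `x` and `y` too.
  obtain ⟨u, hux, huy⟩ : ∃ u, ¬ G.WithinDist (m + 1) u x ∧ ¬ G.WithinDist (m + 1) u y := by
    by_contra! hcon
    have : (Set.univ : Set V) ⊆
        {w | G.WithinDist (m + 1) w x} ∪ {w | G.WithinDist (m + 1) w y} := fun w _ =>
      or_iff_not_imp_left.2 (hcon w)
    have := (Set.ncard_le_ncard this).trans (Set.ncard_union_le _ _)
    rw [Set.ncard_univ, Nat.card_eq_fintype_card] at this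
    have h1 := ncard_withinDist_le hdeg' (m + 1) x
    have h2 := ncard_withinDist_le hdeg' (m + 1) y
    lia
  have hux' : ¬ G.WithinDist m u x := fun h => hux (h.mono_right (by lia))
  have huy' : ¬ G.WithinDist m u y := fun h => huy (h.mono_right (by lia))
  have hne : ∀ {a b}, ¬ G.WithinDist m a b → b ≠ a := by
    rintro a _ h rfl
    exact h (.refl _ _ _)
  have hnadj : ∀ {a b}, ¬ G.WithinDist m a b → ¬ G.Adj b a := fun h hab =>
    h ((WithinDist.cons hab.symm (.refl _ 0 _)).mono_right (by lia))
  -- Exchange: replace `uv` by `xu` and `yv`. Degrees at `u` and `v` are unchanged, while `x` and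
  -- `y` gain one each (two if they coincide).
  by_cases hu : ∃ v, G.Adj u v
  · obtain ⟨v, huv⟩ := hu
    have hvx : ¬ G.WithinDist m v x := fun h => hux (.cons huv h)
    have hvy : ¬ G.WithinDist m v y := fun h => huy (.cons huv h)
    set G₁ := G \ edge u v with hG₁
    have hle : G₁ ≤ G := sdiff_le
    -- A short walk from `y` to `v` would, according to its use of `xu`, put `v` near `y`, close a
    -- short cycle through `uv`, or put `v` near `x`.
    have hfar : ¬ (G₁ ⊔ edge x u).WithinDist m y v := by
      intro h
      have huv' : ¬ G₁.WithinDist m u v := hG u v huv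
      have hK : ∀ p q, (G₁ ⊔ edge x u).Adj p q →
          G₁.Adj p q ∨ p = x ∧ q = u ∨ p = u ∧ q = x := by
        intro p q hpq
        simp only [sup_adj, edge_adj] at hpq
        tauto
      rcases h.of_add_edge hK with h | ⟨i, j, hij, -, h⟩ | ⟨i, j, hij, -, h⟩
      · exact hvy (h.mono hle).symm
      · exact huv' (h.mono_right (by lia))
      · exact hvx ((h.mono hle).symm.mono_right (by lia))
    have hd : ∀ w, (G₁ ⊔ edge x u ⊔ edge y v).ndeg w =
        G.ndeg w + (if w = x then 1 else 0) + (if w = y then 1 else 0) := by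
      intro w
      rw [ndeg_sup_edge (hne hvy), ndeg_sup_edge (hne hux') fun h => hnadj hux' (hle h),
        ndeg_sdiff_edge huv]
      · lia
      · rw [sup_adj, edge_adj]
        rintro (h | ⟨⟨-, rfl⟩ | ⟨-, rfl⟩, -⟩)
        · exact hnadj hvy (hle h)
        · exact huv.ne rfl
        · exact hne hvx rfl
    refine ⟨G₁ ⊔ edge x u ⊔ edge y v, ?_, fun w => (hd w).trans_le (hdeg w), ?_⟩
    · exact ((hG.mono hle).sup_edge fun h => hux' (h.mono hle).symm).sup_edge hfar
    · simp [hd, Finset.sum_add_distrib]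
  · have hu0 : G.ndeg u = 0 := by
      rw [ndeg, Set.ncard_eq_zero]
      ext w
      simpa using fun h => hu ⟨w, h⟩
    have hd := ndeg_sup_edge (hne hux') (hnadj hux')
    refine ⟨G ⊔ edge x u, hG.sup_edge fun h => hux' h.symm, fun w => ?_, ?_⟩
    · rw [hd]
      by_cases hw : w = u
      · subst hw
        simp [hu0, (hne hux').symm, hk]
      · have := hdeg w
        simp only [hw, if_false]
        lia
    · simp [hd, Finset.sum_add_distrib]

/-- A finite form of the Erdős–Sachs theorem: on every large vertex set there is a graph of large
girth and maximum degree at most `k` that misses at most one unit of degree. -/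
theorem exists_noShortCycle_sum_ndeg [Fintype V] (hk : 1 ≤ k) (hm : 1 ≤ m)
    (hcard : 2 * (k + 1) ^ (m + 1) < Fintype.card V) :
    ∃ G : SimpleGraph V, G.NoShortCycle m ∧ (∀ v, G.ndeg v ≤ k) ∧
      k * Fintype.card V ≤ ∑ v, G.ndeg v + 1 := by
  classical
  obtain ⟨G, ⟨hG, hdeg⟩, hmax⟩ := Set.exists_max_image
    {G : SimpleGraph V | G.NoShortCycle m ∧ ∀ v, G.ndeg v ≤ k} (fun G => ∑ v, G.ndeg v)
    (Set.toFinite _) ⟨⊥, fun _ _ h => h.elim, fun v => by simp [ndeg]⟩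
  refine ⟨G, hG, hdeg, ?_⟩
  by_contra! hlt
  have no : ∀ x y, ¬ ∀ v, G.ndeg v + (if v = x then 1 else 0) + (if v = y then 1 else 0) ≤ k := by
    intro x y h
    obtain ⟨H, hH, hHdeg, hsum⟩ := hG.exists_sum_ndeg_lt hk hm hcard h
    exact absurd (hmax H ⟨hH, hHdeg⟩) (by simpa using hsum)
  obtain ⟨x, hx⟩ : ∃ x, G.ndeg x < k := by
    by_contra! hcon
    have := Finset.card_nsmul_le_sum Finset.univ G.ndeg k fun v _ => hcon v
    simp only [Finset.card_univ, smul_eq_mul] at this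
    lia
  -- `y` may equal `x`, when both missing units are at one vertex.
  obtain ⟨y, hy⟩ : ∃ y, G.ndeg y + (if y = x then 1 else 0) < k := by
    by_contra! hcon
    have := Finset.card_nsmul_le_sum Finset.univ
      (fun v => G.ndeg v + (if v = x then 1 else 0)) k fun v _ => hcon v
    simp only [Finset.card_univ, smul_eq_mul, Finset.sum_add_distrib, Finset.sum_ite_eq',
      Finset.mem_univ, if_true] at this
    lia
  refine no x y fun v => ?_
  have := hdeg v
  split_ifs with h1 h2 h2 <;> subst_vars <;> simp_all

theorem ConnectedComponent.ndeg_toSimpleGraph (C : G.ConnectedComponent) (v : C) :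
    C.toSimpleGraph.ndeg v = G.ndeg v := by
  unfold ndeg
  rw [← Set.ncard_image_of_injective _ Subtype.val_injective]
  congr 1
  ext w
  simp only [Set.mem_image, mem_neighborSet]
  constructor
  · rintro ⟨w, hw, rfl⟩
    exact hw
  · intro hw
    exact ⟨⟨w, C.mem_supp_of_adj_mem_supp v.2 hw⟩, hw, rfl⟩

/-- The connected version of `exists_noShortCycle_sum_ndeg`, with an odd number of vertices. -/
theorem exists_connected_noShortCycle_sum_ndeg (hk : 1 ≤ k) (hm : 1 ≤ m) :
    ∃ (V : Type) (_ : Fintype V) (G : SimpleGraph V), G.Connected ∧ Odd (Fintype.card V) ∧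
      G.NoShortCycle m ∧ (∀ v, G.ndeg v ≤ k) ∧ k * Fintype.card V ≤ ∑ v, G.ndeg v + 1 := by
  classical
  set n := 2 * (k + 1) ^ (m + 1) + 1
  obtain ⟨G, hG, hdeg, hsum⟩ := exists_noShortCycle_sum_ndeg (V := Fin n) hk hm (by simp [n])
  -- Odd order forces an odd, hence nonzero, number of odd components.
  have hodd : Odd G.oddComponents.ncard := by
    rw [odd_ncard_oddComponents, Nat.card_fin]
    exact odd_two_mul_add_one _
  obtain ⟨C, hC⟩ := Set.nonempty_of_ncard_ne_zero hodd.pos.ne'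
  refine ⟨C, inferInstance, C.toSimpleGraph, C.connected_toSimpleGraph, ?_,
    hG.comap (Embedding.induce C.supp), fun v => by rw [C.ndeg_toSimpleGraph]; exact hdeg v, ?_⟩
  · rw [← Nat.card_eq_fintype_card]
    exact hC
  -- The degree missing in `C` is at most that missing in the whole graph.
  · have h1 : ∑ v : C, (k - G.ndeg v) ≤ ∑ v, (k - G.ndeg v) := by
      rw [← Finset.sum_subtype (Finset.univ.filter (· ∈ C)) (by simp) fun v => k - G.ndeg v]
      exact Finset.sum_le_sum_of_subset (Finset.filter_subset _ _)
    have h2 : ∑ v : C, (k - G.ndeg v) + ∑ v : C, G.ndeg v = k * Fintype.card C := by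
      simp [← Finset.sum_add_distrib, Nat.sub_add_cancel (hdeg _), mul_comm]
    have h3 : ∑ v, (k - G.ndeg v) + ∑ v, G.ndeg v = k * Fintype.card (Fin n) := by
      simp [← Finset.sum_add_distrib, Nat.sub_add_cancel (hdeg _), mul_comm]
    simp only [C.ndeg_toSimpleGraph]
    lia

/-! ### Overfull graphs; transfer along embeddings -/

theorem sum_ndeg_eq [Fintype V] (G : SimpleGraph V) [DecidableEq V] [DecidableRel G.Adj] :
    ∑ v, G.ndeg v = 2 * G.edgeFinset.card := by
  rw [← sum_degrees_eq_twice_card_edges]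
  exact Finset.sum_congr rfl fun v _ => ndeg_eq_degree v

/-- An overfull graph is not edge-colourable. -/
theorem not_edgeColourable_of_sum_ndeg [Fintype V] (hodd : Odd (Fintype.card V))
    (h : k * Fintype.card V < ∑ v, G.ndeg v + k) : ¬ G.EdgeColourable k := by
  classical
  rintro ⟨c, hc⟩
  -- A colour class is a matching: it covers an even number of vertices, so it misses at least one.
  have hclass : ∀ i, 2 * {e : G.edgeSet | c e = i}.toFinset.card + 1 ≤ Fintype.card V := by
    intro i
    have hdisj : Set.PairwiseDisjoint (↑{e : G.edgeSet | c e = i}.toFinset : Set G.edgeSet)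
        fun e => (e : Sym2 V).toFinset := by
      intro e he f hf hef
      rw [Function.onFun, Finset.disjoint_left]
      intro v hve hvf
      rw [Sym2.mem_toFinset] at hve hvf
      simp only [Set.coe_toFinset, Set.mem_ofPred_eq] at he hf
      exact hc e f hef ⟨v, hve, hvf⟩ (he.trans hf.symm)
    have hle := Finset.card_le_univ
      ({e : G.edgeSet | c e = i}.toFinset.biUnion fun e => (e : Sym2 V).toFinset)
    rw [Finset.card_biUnion hdisj, Finset.sum_congr rfl fun e _ =>
      Sym2.card_toFinset_of_not_isDiag _ (G.not_isDiag_of_mem_edgeSet e.2)] at hle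
    simp only [Finset.sum_const, smul_eq_mul] at hle
    obtain ⟨r, hr⟩ := hodd
    lia
  have hE : ∑ i, {e : G.edgeSet | c e = i}.toFinset.card = G.edgeFinset.card := by
    rw [edgeFinset_card, ← Finset.card_univ,
      Finset.card_eq_sum_card_fiberwise (f := c) (t := Finset.univ) (by simp [Set.MapsTo])]
    refine Finset.sum_congr rfl fun i _ => congrArg _ ?_
    ext e
    simp
  have hdeg := G.sum_ndeg_eq
  have := Finset.sum_le_sum (s := Finset.univ) fun i (_ : i ∈ Finset.univ) => hclass i
  simp only [Finset.sum_add_distrib, ← Finset.mul_sum, hE, Finset.sum_const, Finset.card_univ,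
    Fintype.card_fin, smul_eq_mul, mul_one] at this
  lia

theorem EdgeColourable.comap {H : SimpleGraph W} (f : G ↪g H) (h : H.EdgeColourable k) :
    G.EdgeColourable k := by
  obtain ⟨c, hc⟩ := h
  refine ⟨fun e => c (f.mapEdgeSet e), fun e e' hne ⟨v, hv, hv'⟩ => ?_⟩
  refine hc _ _ (f.mapEdgeSet.injective.ne hne) ⟨f v, ?_, ?_⟩
  · exact Sym2.mem_map.2 ⟨v, hv, rfl⟩
  · exact Sym2.mem_map.2 ⟨v, hv', rfl⟩

theorem IsCutVertex.map {H : SimpleGraph W} (f : G ≃g H) {v : V} (h : G.IsCutVertex v) :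
    H.IsCutVertex (f v) := by
  obtain ⟨x, y, hxy, hn⟩ := h
  refine ⟨⟨f x, f.injective.ne x.2⟩, ⟨f y, f.injective.ne y.2⟩, hxy.map f.toHom, fun hr => hn ?_⟩
  let g : H.induce ({f v}ᶜ : Set W) →g G.induce ({v}ᶜ : Set V) :=
    { toFun := fun w => ⟨f.symm w, fun hw => w.2 (by
        rw [Set.mem_singleton_iff] at hw ⊢
        exact f.symm_apply_eq.1 hw)⟩
      map_rel' := fun {a b} hab => f.symm.map_adj_iff.2 hab }
  have hg : ∀ (w : ({v}ᶜ : Set V)) (hw : f w ∈ ({f v}ᶜ : Set W)), g ⟨f w, hw⟩ = w := fun w _ =>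
    Subtype.ext (f.symm_apply_apply w)
  rw [← hg x (f.injective.ne x.2), ← hg y (f.injective.ne y.2)]
  exact hr.map g

/-! ### Two copies joined by a bridge -/

/-- Two copies of a graph, joined by an edge between the two copies of the vertex `x`. -/
def joinCopies (G : SimpleGraph V) (x : V) : SimpleGraph (V × Bool) where
  Adj p q := p.2 = q.2 ∧ G.Adj p.1 q.1 ∨ p.2 ≠ q.2 ∧ p.1 = x ∧ q.1 = x
  symm := ⟨by
    rintro p q (⟨h, h'⟩ | ⟨h, h', h''⟩)
    · exact .inl ⟨h.symm, h'.symm⟩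
    · exact .inr ⟨h.symm, h'', h'⟩⟩
  loopless := ⟨by simp⟩

section joinCopies

variable {x : V}

theorem joinCopies_adj {p q : V × Bool} : (G.joinCopies x).Adj p q ↔
    p.2 = q.2 ∧ G.Adj p.1 q.1 ∨ p.2 ≠ q.2 ∧ p.1 = x ∧ q.1 = x := Iff.rfl

/-- The embedding of a graph as one of the copies in `joinCopies`. -/
def joinCopiesEmbedding (G : SimpleGraph V) (x : V) (i : Bool) : G ↪g G.joinCopies x where
  toFun v := (v, i)
  inj' _ _ h := congrArg Prod.fst h
  map_rel_iff' := fun {a b} => by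
    change i = i ∧ G.Adj a b ∨ i ≠ i ∧ a = x ∧ b = x ↔ G.Adj a b
    simp

theorem joinCopies_connected (hG : G.Connected) : (G.joinCopies x).Connected := by
  have : Nonempty V := hG.nonempty
  have key : ∀ p, (G.joinCopies x).Reachable p (x, true) := by
    rintro ⟨v, i⟩
    have h1 : (G.joinCopies x).Reachable (v, i) (x, i) :=
      (hG.preconnected v x).map (joinCopiesEmbedding G x i).toHom
    cases i
    · exact h1.trans (Adj.reachable (.inr (by simp)))
    · exact h1
  exact ⟨fun p q => (key p).trans (key q).symm⟩

theorem ndeg_joinCopies [Finite V] [DecidableEq V] (v : V) (i : Bool) :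
    (G.joinCopies x).ndeg (v, i) = G.ndeg v + if v = x then 1 else 0 := by
  unfold ndeg
  have hinj : (fun w : V => (w, i)).Injective := fun _ _ h => congrArg Prod.fst h
  split_ifs with h
  · subst h
    have : (G.joinCopies v).neighborSet (v, i) =
        insert (v, !i) ((fun w => (w, i)) '' G.neighborSet v) := by
      ext ⟨w, j⟩
      simp only [mem_neighborSet, joinCopies_adj, Set.mem_insert_iff, Set.mem_image,
        Prod.mk.injEq]
      cases i <;> cases j <;> simp
    rw [this, Set.ncard_insert_of_notMem (by simp), Set.ncard_image_of_injective _ hinj]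
  · have : (G.joinCopies x).neighborSet (v, i) = (fun w => (w, i)) '' G.neighborSet v := by
      ext ⟨w, j⟩
      simp only [mem_neighborSet, joinCopies_adj, Set.mem_image, Prod.mk.injEq]
      cases i <;> cases j <;> simp [h]
    rw [this, Set.ncard_image_of_injective _ hinj, add_zero]

/-- For an edge inside a copy, collapse the other copy to `x`: a detour around the edge maps to one
in `G`, no longer. The joining edge has no detour, since without it the `Bool` coordinate is
constant along walks. -/
theorem NoShortCycle.joinCopies (hG : G.NoShortCycle m) (x : V) :
    (G.joinCopies x).NoShortCycle m := by
  classical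
  rintro ⟨a, i⟩ ⟨b, j⟩ hab hw
  simp only [joinCopies_adj] at hab
  rcases hab with ⟨rfl, hab⟩ | ⟨hij, rfl, rfl⟩
  · refine hG a b hab ?_
    have := hw.map (H := G \ edge a b) (fun p => if p.2 = i then p.1 else x) ?_
    · simpa using this
    · rintro ⟨p, i'⟩ ⟨q, j'⟩ h
      simp only [sdiff_adj, joinCopies_adj, edge_adj, Prod.mk.injEq] at h ⊢
      grind
  · have := hw.map (H := (⊥ : SimpleGraph Bool)) Prod.snd ?_
    · obtain ⟨p, -⟩ := this
      exact hij (reachable_bot.1 ⟨p⟩)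
    · rintro ⟨p, i'⟩ ⟨q, j'⟩ h
      simp only [sdiff_adj, joinCopies_adj, edge_adj, Prod.mk.injEq] at h ⊢
      cases i <;> cases j <;> cases i' <;> cases j' <;> simp_all <;> tauto

/-- The only edge between the copies ends at `(x, true)`. The neighbour `y` ensures that its copy
retains a vertex after deletion. -/
theorem joinCopies_isCutVertex (hG : G.Connected) (hx : ∃ y, G.Adj x y) :
    (G.joinCopies x).IsCutVertex (x, true) := by
  obtain ⟨y, hy⟩ := hx
  refine ⟨⟨(y, true), by simpa using hy.ne'⟩, ⟨(x, false), by simp⟩,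
    (joinCopies_connected hG).preconnected _ _, fun ⟨p⟩ => ?_⟩
  have h : WithinDist _ p.length _ _ := ⟨p, le_rfl⟩
  obtain ⟨q, -⟩ := h.map (H := (⊥ : SimpleGraph Bool)) (fun w => w.1.2) (by
    rintro ⟨⟨a, i⟩, ha⟩ ⟨⟨b, j⟩, hb⟩ hab
    simp only [comap_adj, Function.Embedding.subtype_apply, joinCopies_adj, Set.mem_compl_iff,
      Set.mem_singleton_iff, Prod.mk.injEq] at ha hb hab ⊢
    cases i <;> cases j <;> simp_all)
  simpa using reachable_bot.1 ⟨q⟩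

end joinCopies

/-! ### Assembly of the theorem -/

/-- A regular graph on an arbitrary finite vertex type may be moved to some `Fin n`, keeping
its connectedness, girth, colourability and cut vertices. -/
theorem exists_fin_of_fintype [Fintype V] (G : SimpleGraph V) (hG : G.Connected)
    (hdeg : ∀ v, G.ndeg v = k) (hcyc : G.NoShortCycle k) (hcol : ¬ G.EdgeColourable k)
    (heven : Even k → Odd (Fintype.card V)) (hodd : Odd k → ∃ v, G.IsCutVertex v) :
    ∃ (n : ℕ) (G : SimpleGraph (Fin n)) (_ : DecidableRel G.Adj),
      G.Connected ∧ G.IsRegularOfDegree k ∧ ((k + 2 : ℕ) : ℕ∞) ≤ G.egirth ∧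
        ¬ G.EdgeColourable k ∧
        (Even k → Odd n) ∧ (Odd k → ∃ v, G.IsCutVertex v) := by
  classical
  let f : G ≃g G.overFin rfl := G.overFinIso rfl
  refine ⟨_, G.overFin rfl, inferInstance, f.connected_iff.1 hG, fun v => ?_, ?_,
    fun h => hcol (h.comap f.toEmbedding), heven, fun h => ?_⟩
  · rw [← hdeg (f.symm v), ndeg_eq_degree, f.symm.degree_eq]
  · rw [← f.egirth_eq]
    exact hcyc.le_egirth
  · obtain ⟨v, hv⟩ := hodd h
    exact ⟨f v, hv.map f⟩

end SimpleGraph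

open SimpleGraph in
theorem mainTheorem6 (k : ℕ) (hk : 2 ≤ k) :
    ∃ (n : ℕ) (G : SimpleGraph (Fin n)) (_ : DecidableRel G.Adj),
      G.Connected ∧ G.IsRegularOfDegree k ∧ ((k + 2 : ℕ) : ℕ∞) ≤ G.egirth ∧
        ¬ G.EdgeColourable k ∧
        (Even k → Odd n) ∧ (Odd k → ∃ v, G.IsCutVertex v) := by
  classical
  obtain ⟨V, _, G, hG, hV, hcyc, hdeg, hsum⟩ :=
    exists_connected_noShortCycle_sum_ndeg (k := k) (m := k) (by lia) (by lia)
  have hcol : ¬ G.EdgeColourable k := not_edgeColourable_of_sum_ndeg hV (by lia)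
  have hE := G.sum_ndeg_eq
  have hle : ∑ v, G.ndeg v ≤ ∑ _ : V, k := Finset.sum_le_sum fun v _ => hdeg v
  have hconst : ∑ _ : V, k = k * Fintype.card V := by simp [mul_comm]
  rcases Nat.even_or_odd k with hke | hko
  -- `k * Fintype.card V` and the degree sum are both even, so they cannot differ by one.
  · have heq : ∑ v, G.ndeg v = ∑ _ : V, k := by
      obtain ⟨r, hr⟩ := hke.mul_right (Fintype.card V)
      lia
    rw [Finset.sum_eq_sum_iff_of_le fun v _ => hdeg v] at heq
    exact exists_fin_of_fintype G hG (fun v => heq v (Finset.mem_univ v)) hcyc hcol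
      (fun _ => hV) fun h => absurd hke (Nat.not_even_iff_odd.2 h)
  -- Now `k * Fintype.card V` is odd, so exactly one unit is missing, at a single vertex `x`.
  · have hlt : ∑ v, G.ndeg v < ∑ _ : V, k := by
      obtain ⟨r, hr⟩ := hko.mul hV
      lia
    obtain ⟨x, -, hx⟩ := Finset.exists_lt_of_sum_lt hlt
    have hreg : ∀ v, G.ndeg v + (if v = x then 1 else 0) = k := by
      have hle' : ∀ v ∈ Finset.univ, G.ndeg v + (if v = x then 1 else 0) ≤ k := by
        intro v _
        have := hdeg v
        split_ifs with h
        · subst h; lia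
        · lia
      have h := (Finset.sum_eq_sum_iff_of_le hle').1 (le_antisymm (Finset.sum_le_sum hle') (by
        rw [Finset.sum_add_distrib, Finset.sum_ite_eq' Finset.univ x, if_pos (Finset.mem_univ x)]
        lia))
      exact fun v => h v (Finset.mem_univ v)
    have hnbr : ∃ y, G.Adj x y := by
      have := hreg x
      rw [if_pos rfl] at this
      exact Set.nonempty_of_ncard_ne_zero (s := G.neighborSet x) (by rw [← ndeg]; lia)
    exact exists_fin_of_fintype (G.joinCopies x) (joinCopies_connected hG)
      (fun ⟨v, i⟩ => by rw [ndeg_joinCopies, hreg]) (hcyc.joinCopies x)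
      (fun h => hcol (h.comap (joinCopiesEmbedding G x true)))
      (fun h => absurd h (Nat.not_even_iff_odd.2 hko)) fun _ => ⟨_, joinCopies_isCutVertex hG hnbr⟩
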